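/- A *subordinator* is a process $\zeta=(\zeta(t))_{t\ge 0}$ with $\zeta(0)=0$, with (almost surely) nondecreasing right-continuous paths and with stationary independent increments. It has (zero drift and) *Lévy density* $\rho\ge 0$ on $(0,\infty)$ if, for all $t\ge0$ and $w>0$, $$\mathbb E\bigl[e^{-w\zeta(t)}\bigr]=\exp\Bigl(-t\int_0^\infty(1-e^{-ws})\rho(s)\,ds\Bigr),\qquad \int_0^\infty(1-e^{-ws})\rho(s)\,ds<\infty .$$ It is *in the class $\mathcal B$* if moreover $\rho(s)=\int_0^\infty e^{-sy}\,\mu(dy)$, $s>0$, for some nonnegative measure $\mu$ on $(0,\infty)$. Let $\gamma_\theta$ denote a gamma variable with shape $\theta>0$ and scale $1$. A *gamma(1) subordinator with scale $1/\delta$* is a subordinator $G$ such that $G(t)\stackrel{d}{=}\gamma_t/\delta$ for every $t>0$. **Theorem 6.1.** Let $\delta>0$, and let $q$ be a measurable function on $[\delta,\infty)$ with $0\le q(x)\le 1$ for $x\ge\delta$. Let $\Omega_\delta$ be a subordinator in $\mathcal B$ with Lévy density $$\rho_{\Omega_\delta}(s)=\int_\delta^\infty e^{-sx}q(x)\,dx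 .$$ Then there is a subordinator $\widehat\Omega_\delta$ in $\mathcal B$, independent of $\Omega_\delta$ (on a product extension of the probability space), with Lévy density $$\rho_{\widehat\Omega_\delta}(s)=\int_\delta^\infty e^{-sx}[1-q(x)]\,dx .$$ Every gamma(1) subordinator with scale $1/\delta$ has Lévy density $s^{-1}e^{-s\delta}$, and, for all $s>0$, $$s^{-1}e^{-s\delta}=\rho_{\widehat\Omega_\delta}(s)+\rho_{\Omega_\delta}(s).$$ Moreover, whenever $\Omega_\delta$ and $\widehat\Omega_\delta$ are independent subordinators in $\mathcal B$ with these Lévy densities, $\widehat\Omega_\delta+\Omega_\delta$ is a gamma(1) subordinator with scale $1/\delta$; in particular, for each fixed $\theta>0$, $$\gamma_\theta/\delta\stackrel{d}{=}\widehat\Omega_\delta(\theta)+\Omega_\delta(\theta).$$ -/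

import Mathlib

open MeasureTheory ProbabilityTheory Set
open scoped NNReal

/-- A real process `ζ = (ζ t; t ≥ 0)` on the probability space `(Ω, P)` is a subordinator: it starts
at `0`, almost all of its paths are nondecreasing and right continuous, and it has stationary
independent increments. -/
structure IsSubordinator {Ω : Type*} [MeasurableSpace Ω] (ζ : ℝ≥0 → Ω → ℝ) (P : Measure Ω) :
    Prop where
  measurable : ∀ t, Measurable (ζ t)
  zero : ∀ᵐ ω ∂P, ζ 0 ω = 0
  monotone : ∀ᵐ ω ∂P, Monotone fun t => ζ t ω
  rightContinuous : ∀ᵐ ω ∂P, ∀ t, ContinuousWithinAt (fun u => ζ u ω) (Ici t) t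
  indepIncrements : HasIndepIncrements ζ P
  stationary : ∀ s t, IdentDistrib (fun ω => ζ (s + t) ω - ζ s ω) (ζ t) P P

/-- The process `ζ` has no drift, and its Lévy measure has density `ρ` on `(0, ∞)`:
`𝔼[exp (-w ζ(t))] = exp (-t ψ(w))` with the finite Laplace exponent
`ψ(w) = ∫₀^∞ (1 - exp (-w s)) ρ(s) ds`. -/
structure HasLevyDensity {Ω : Type*} [MeasurableSpace Ω] (ζ : ℝ≥0 → Ω → ℝ) (P : Measure Ω)
    (ρ : ℝ → ℝ) : Prop where
  nonneg : ∀ s, 0 < s → 0 ≤ ρ s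
  integrable : ∀ w : ℝ, 0 < w → IntegrableOn (fun s => (1 - Real.exp (-(w * s))) * ρ s) (Ioi 0)
  laplace : ∀ (t : ℝ≥0) (w : ℝ), 0 < w →
    ∫ ω, Real.exp (-(w * ζ t ω)) ∂P =
      Real.exp (-(t * ∫ s in Ioi (0 : ℝ), (1 - Real.exp (-(w * s))) * ρ s))

/-- `ρ` is completely monotone on `(0, ∞)`, in the form of a (convergent) Laplace transform
`ρ(s) = ∫₀^∞ exp (-s y) μ(dy)` of a nonnegative measure `μ`. -/
def IsLaplaceOfMeasure (ρ : ℝ → ℝ) : Prop :=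
  ∃ μ : Measure ℝ, ∀ s, 0 < s →
    IntegrableOn (fun y => Real.exp (-(s * y))) (Ioi 0) μ ∧
      ρ s = ∫ y in Ioi (0 : ℝ), Real.exp (-(s * y)) ∂μ

/-- `ζ` is a subordinator in Bondesson's class `𝓑` (its Lévy density is completely monotone), and
its Lévy density is `ρ`. -/
structure IsBSubordinator {Ω : Type*} [MeasurableSpace Ω] (ζ : ℝ≥0 → Ω → ℝ) (P : Measure Ω)
    (ρ : ℝ → ℝ) : Prop where
  isSubordinator : IsSubordinator ζ P
  hasLevyDensity : HasLevyDensity ζ P ρ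
  completelyMonotone : IsLaplaceOfMeasure ρ

/-- `G` is a gamma(1) subordinator with scale `1/δ`: a subordinator such that, for `t > 0`, `G t` is
distributed as `γ_t / δ`, with `γ_t` a gamma variable of shape `t` and scale `1`. -/
structure IsGammaSubordinator {Ω : Type*} [MeasurableSpace Ω] (δ : ℝ) (G : ℝ≥0 → Ω → ℝ)
    (P : Measure Ω) : Prop where
  isSubordinator : IsSubordinator G P
  gamma : ∀ t : ℝ≥0, 0 < t → IdentDistrib (G t) (fun x : ℝ => x / δ) P (gammaMeasure t 1)

/-- The function `s ↦ ∫_δ^∞ exp (-s x) q(x) dx`. -/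
noncomputable def laplaceFrom (δ : ℝ) (q : ℝ → ℝ) (s : ℝ) : ℝ :=
  ∫ x in Ioi δ, Real.exp (-(s * x)) * q x

/-- The two processes are independent (as random elements of the space of all paths). -/
def IndepProcesses {Ω : Type*} [MeasurableSpace Ω] (X Y : ℝ≥0 → Ω → ℝ) (P : Measure Ω) : Prop :=
  IndepFun (fun ω t => X t ω) (fun ω t => Y t ω) P

/-! Integrating `exp (-(s * x))` over `x > δ` gives `s⁻¹ * exp (-(s * δ))`, the gamma Lévy density;
weighting the integrand by `1 = (1 - q) + q` splits it into the two densities of the theorem.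
Laplace exponents of independent subordinators add, and Frullani's integral evaluates the total
exponent as `log ((δ + w) / δ)`, which is that of `γ_t / δ`. Since laws on `[0, ∞)` are determined
by their Laplace transforms, the sum has gamma marginals (`isGammaSubordinator_add`); it is a
subordinator by `IsSubordinator.add`.

The complementary subordinator has to be constructed. Its density satisfies `s * ρ s ≤ exp (-(δ *
s))`, so its jumps have finite mean and can simply be summed: take a Poisson point process of
intensity `dt ⊗ ρ(s) ds` and add the jump sizes up to time `t`. The process is realised as countably
many independent finite Poisson clusters. Campbell's formula (`lintegral_pointSum`) gives
convergence, and the exponential formula (`integral_exp_pointSum`) gives the joint transform of the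
increments, hence independence, stationarity and the Lévy density. -/

/-! ### Uniqueness of laws from moments and from Laplace transforms. -/

open Filter Topology in
/-- A probability measure on `[0, 1]` is determined by its moments. -/
theorem ext_of_moments_eq {μ ν : Measure ℝ} [IsProbabilityMeasure μ] [IsProbabilityMeasure ν]
    (hμ : ∀ᵐ x ∂μ, |x| ≤ 1) (hν : ∀ᵐ x ∂ν, |x| ≤ 1)
    (h : ∀ n : ℕ, ∫ x, x ^ n ∂μ = ∫ x, x ^ n ∂ν) : μ = ν := by
  -- Bounded support allows the exponential series to be integrated term by term, so the
  -- characteristic function is a power series in the moments.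
  have key : ∀ (ρ : Measure ℝ) [IsProbabilityMeasure ρ], (∀ᵐ x ∂ρ, |x| ≤ 1) → ∀ t : ℝ,
      charFun ρ t = ∑' n : ℕ, ((t * Complex.I) ^ n / (n.factorial : ℂ)) * ((∫ x, x ^ n ∂ρ : ℝ) : ℂ) := by
    intro ρ _ hρ t
    have hint : ∀ n : ℕ, Integrable (fun x : ℝ => x ^ n) ρ := fun n => by
      refine Integrable.of_bound (by fun_prop) 1 ?_
      filter_upwards [hρ] with x hx
      rw [Real.norm_eq_abs, abs_pow]
      exact pow_le_one₀ (abs_nonneg x) hx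
    have e : ∀ n : ℕ, ((t * Complex.I) ^ n / (n.factorial : ℂ)) * ((∫ x, x ^ n ∂ρ : ℝ) : ℂ) =
        ∫ x : ℝ, ((t * Complex.I) ^ n / (n.factorial : ℂ)) * ((x ^ n : ℝ) : ℂ) ∂ρ := by
      intro n
      rw [integral_const_mul, integral_complex_ofReal]
    simp_rw [e]
    rw [charFun_apply_real]
    rw [integral_tsum_of_summable_integral_norm (F := fun (n : ℕ) (x : ℝ) =>
      ((t * Complex.I) ^ n / (n.factorial : ℂ)) * ((x ^ n : ℝ) : ℂ))]
    · refine integral_congr_ae (Eventually.of_forall fun x => ?_)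
      have := (NormedSpace.expSeries_div_hasSum_exp (t * Complex.I * x)).tsum_eq
      rw [← Complex.exp_eq_exp_ℂ] at this
      simp only
      rw [show (t : ℂ) * x * Complex.I = t * Complex.I * x by ring, ← this]
      congr 1 with n
      push_cast
      ring
    · exact fun n => ((hint n).ofReal).const_mul _
    · refine Summable.of_nonneg_of_le (fun n => integral_nonneg fun x => norm_nonneg _) ?_
        (Real.summable_pow_div_factorial |t|)
      intro n
      calc _ ≤ ∫ _x, |t| ^ n / n.factorial ∂ρ := by
            refine integral_mono_ae (((hint n).ofReal).const_mul _).norm (integrable_const _) ?_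
            filter_upwards [hρ] with x hx
            have : |x| ^ n ≤ 1 := pow_le_one₀ (abs_nonneg x) hx
            simp only [norm_mul, norm_div, norm_pow, Complex.norm_real, Complex.norm_I, mul_one,
              Real.norm_eq_abs, Complex.norm_natCast]
            exact mul_le_of_le_one_right (by positivity) this
        _ = _ := by simp
  refine Measure.ext_of_charFun (funext fun t => ?_)
  rw [key μ hμ, key ν hν]
  simp_rw [h]

/-- Distributions on `[0, ∞)` are determined by their Laplace transforms. -/
theorem ext_of_laplace_eq {μ ν : Measure ℝ} [IsProbabilityMeasure μ] [IsProbabilityMeasure ν]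
    (hμ : ∀ᵐ x ∂μ, 0 ≤ x) (hν : ∀ᵐ x ∂ν, 0 ≤ x)
    (h : ∀ w : ℝ, 0 < w → ∫ x, Real.exp (-(w * x)) ∂μ = ∫ x, Real.exp (-(w * x)) ∂ν) : μ = ν := by
  have hm : Measurable fun x : ℝ => Real.exp (-x) := by fun_prop
  have hl : Measurable fun x : ℝ => -Real.log x := by fun_prop
  have pow_eq : ∀ (n : ℕ) (x : ℝ), Real.exp (-x) ^ n = Real.exp (-(n * x)) := fun n x => by
    rw [← Real.exp_nat_mul]; ring_nf
  have bound : ∀ x : ℝ, 0 ≤ x → |Real.exp (-x)| ≤ 1 := fun x hx => by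
    rw [abs_of_pos (Real.exp_pos _)]; exact Real.exp_le_one_iff.2 (by linarith)
  have hms : MeasurableSet {x : ℝ | |x| ≤ 1} := measurableSet_le (by fun_prop) (by fun_prop)
  have := Measure.isProbabilityMeasure_map (μ := μ) hm.aemeasurable
  have := Measure.isProbabilityMeasure_map (μ := ν) hm.aemeasurable
  -- Under `x ↦ exp (-x)` the `n`-th moment becomes the Laplace transform at `n`; the case `n = 0`
  -- is the total mass.
  have key : μ.map (fun x => Real.exp (-x)) = ν.map fun x => Real.exp (-x) := by
    refine ext_of_moments_eq ?_ ?_ fun n => ?_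
    · rw [ae_map_iff hm.aemeasurable hms]
      exact hμ.mono fun x hx => bound x hx
    · rw [ae_map_iff hm.aemeasurable hms]
      exact hν.mono fun x hx => bound x hx
    · rw [integral_map hm.aemeasurable (by fun_prop), integral_map hm.aemeasurable (by fun_prop)]
      simp_rw [pow_eq]
      rcases Nat.eq_zero_or_pos n with rfl | hn
      · simp
      · exact h n (by exact_mod_cast hn)
  have inv : ∀ ρ : Measure ℝ, (ρ.map fun x => Real.exp (-x)).map (fun x => -Real.log x) = ρ := by
    intro ρ
    rw [Measure.map_map hl hm]
    simp [Function.comp_def]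
  rw [← inv μ, key, inv ν]

/-! ### The gamma law and its Lévy density. -/

/-- The Laplace transform of the gamma distribution with shape `t` and scale `1 / δ`. -/
theorem integral_exp_neg_mul_div_gammaMeasure {t δ w : ℝ} (ht : 0 < t) (hδ : 0 < δ) (hw : 0 < w) :
    ∫ x, Real.exp (-(w * (x / δ))) ∂gammaMeasure t 1 =
      Real.exp (-(t * Real.log ((δ + w) / δ))) := by
  have hb : 0 < (δ + w) / δ := by positivity
  rw [gammaMeasure, show gammaPDF t 1 = fun x => ENNReal.ofReal (gammaPDFReal t 1 x) from rfl,
    integral_withDensity_eq_integral_toReal_smul (by fun_prop) (by simp)]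
  have e : ∀ x : ℝ, x ∈ Ioi (0 : ℝ) →
      (ENNReal.ofReal (gammaPDFReal t 1 x)).toReal • Real.exp (-(w * (x / δ))) =
      (Real.Gamma t)⁻¹ * (x ^ (t - 1) * Real.exp (-((δ + w) / δ * x))) := by
    intro x hx
    rw [ENNReal.toReal_ofReal (gammaPDFReal_nonneg ht one_pos x), gammaPDFReal,
      if_pos (mem_Ioi.1 hx).le, smul_eq_mul, mul_assoc, ← Real.exp_add]
    rw [show -(1 * x) + -(w * (x / δ)) = -((δ + w) / δ * x) by field_simp; ring]
    simp [mul_assoc]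
  rw [← integral_add_compl (measurableSet_Ici (a := (0 : ℝ)))]
  · rw [integral_Ici_eq_integral_Ioi, setIntegral_congr_fun measurableSet_Ioi e,
      integral_const_mul, Real.integral_rpow_mul_exp_neg_mul_Ioi ht hb,
      setIntegral_congr_fun (g := fun _ => 0) measurableSet_Ici.compl]
    · have := (Real.Gamma_pos_of_pos ht).ne'
      rw [integral_zero, add_zero, Real.rpow_def_of_pos (by positivity), Real.log_div one_ne_zero hb.ne',
        Real.log_one]
      field_simp
      ring_nf
    · intro x hx
      simp only [mem_compl_iff, mem_Ici, not_le] at hx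
      simp [gammaPDFReal, not_le.2 hx]
  · have hp : IsProbabilityMeasure (gammaMeasure t 1) :=
      isProbabilityMeasure_gammaMeasure ht one_pos
    have : Integrable (fun x => Real.exp (-(w * (x / δ)))) (gammaMeasure t 1) := by
      refine Integrable.of_bound (by fun_prop) 1 ?_
      have h0 : ∀ᵐ x ∂gammaMeasure t 1, 0 ≤ x := by
        rw [ae_iff, gammaMeasure, show {a : ℝ | ¬ 0 ≤ a} = Iio 0 by ext; simp,
          withDensity_apply _ measurableSet_Iio, lintegral_gammaPDF_of_nonpos le_rfl]
      filter_upwards [h0] with x hx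
      rw [Real.norm_eq_abs, abs_of_pos (Real.exp_pos _)]
      exact Real.exp_le_one_iff.2 (by have : 0 ≤ w * (x / δ) := by positivity
                                      linarith)
    rwa [gammaMeasure, show gammaPDF t 1 = fun x => ENNReal.ofReal (gammaPDFReal t 1 x) from rfl,
      integrable_withDensity_iff_integrable_smul' (by fun_prop) (by simp)] at this

theorem one_sub_exp_neg_nonneg {x : ℝ} (hx : 0 ≤ x) : 0 ≤ 1 - Real.exp (-x) := by
  have := Real.exp_le_one_iff.2 (neg_nonpos.2 hx)
  linarith

theorem one_sub_exp_neg_le (x : ℝ) : 1 - Real.exp (-x) ≤ x := by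
  have := Real.add_one_le_exp (-x)
  linarith

theorem integrableOn_exp_neg_mul {δ s : ℝ} (hs : 0 < s) :
    IntegrableOn (fun x => Real.exp (-(s * x))) (Ioi δ) := by
  have := integrableOn_exp_mul_Ioi (neg_lt_zero.2 hs) δ
  simpa only [neg_mul] using this

theorem integral_exp_neg_mul_Ioi {δ s : ℝ} (hs : 0 < s) :
    ∫ x in Ioi δ, Real.exp (-(s * x)) = s⁻¹ * Real.exp (-(s * δ)) := by
  have := integral_exp_mul_Ioi (neg_lt_zero.2 hs) δ
  simp only [neg_mul] at this
  rw [this]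
  field_simp

/-- The bound `1 - exp (-(w * s)) ≤ w * s` cancels the singularity `s⁻¹` at the origin. -/
theorem integrableOn_gamma_levy {δ w : ℝ} (hδ : 0 < δ) (hw : 0 < w) :
    IntegrableOn (fun s => (1 - Real.exp (-(w * s))) * (s⁻¹ * Real.exp (-(s * δ)))) (Ioi 0) := by
  refine Integrable.mono' ((integrableOn_exp_neg_mul (δ := 0) hδ).const_mul w) ?_ ?_
  · exact (by fun_prop : Measurable _).aestronglyMeasurable
  · filter_upwards [ae_restrict_mem measurableSet_Ioi] with s hs
    have hs : 0 < s := hs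
    have h1 := one_sub_exp_neg_nonneg (mul_pos hw hs).le
    rw [Real.norm_eq_abs, abs_of_nonneg (by positivity)]
    calc _ ≤ (w * s) * (s⁻¹ * Real.exp (-(s * δ))) := by
          gcongr; exact one_sub_exp_neg_le _
      _ = _ := by rw [mul_comm δ s]; field_simp

open Filter Topology in
/-- The Laplace exponent of the gamma subordinator. -/
theorem integral_gamma_levy {δ w : ℝ} (hδ : 0 < δ) (hw : 0 < w) :
    ∫ s in Ioi (0 : ℝ), (1 - Real.exp (-(w * s))) * (s⁻¹ * Real.exp (-(s * δ))) =
      Real.log ((δ + w) / δ) := by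
  -- This is the Frullani form for `x ↦ exp (-x)` with rates `δ` and `δ + w`; the limits `1` at `0`
  -- and `0` at infinity leave the logarithm of the ratio.
  have e : (fun s : ℝ => (1 - Real.exp (-(w * s))) * (s⁻¹ * Real.exp (-(s * δ)))) =
      fun s => s⁻¹ • (Real.exp (-(δ * s)) - Real.exp (-((δ + w) * s))) := by
    ext s
    rw [show -((δ + w) * s) = -(w * s) + -(δ * s) by ring, Real.exp_add, smul_eq_mul, mul_comm s δ]
    ring
  have hint := integrableOn_gamma_levy hδ hw
  rw [e] at hint ⊢
  have hc : Continuous fun x : ℝ => Real.exp (-x) := by fun_prop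
  have := Frullani.integral_Ioi_eq (f := fun x : ℝ => Real.exp (-x)) (L := 1) (R := 0)
    (hc.locallyIntegrable.locallyIntegrableOn _) hδ (by positivity : 0 < δ + w)
    ((by simpa using hc.tendsto 0 : Tendsto (fun x : ℝ => Real.exp (-x)) (𝓝 0) (𝓝 1)).mono_left nhdsWithin_le_nhds)
    Real.tendsto_exp_neg_atTop_nhds_zero hint
  rw [this]
  simp

/-! ### Lévy densities given by a weight on `(δ, ∞)`. -/

section LaplaceFrom

variable {δ : ℝ} {q : ℝ → ℝ}

theorem integrableOn_exp_neg_mul_mul (hqm : AEMeasurable q (volume.restrict (Ici δ)))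
    (hq0 : ∀ x, δ ≤ x → 0 ≤ q x) (hq1 : ∀ x, δ ≤ x → q x ≤ 1) {s : ℝ} (hs : 0 < s) :
    IntegrableOn (fun x => Real.exp (-(s * x)) * q x) (Ioi δ) := by
  have hq' := hqm.mono_measure (Measure.restrict_mono Ioi_subset_Ici_self le_rfl)
  refine (integrableOn_exp_neg_mul hs).mono' ?_ ?_
  · exact (by fun_prop : AEMeasurable _ _).aestronglyMeasurable
  · filter_upwards [ae_restrict_mem measurableSet_Ioi] with x hx
    have hx : δ < x := hx
    have := hq0 x hx.le
    rw [Real.norm_eq_abs, abs_of_nonneg (by positivity)]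
    exact mul_le_of_le_one_right (by positivity) (hq1 x hx.le)

theorem laplaceFrom_one_sub_add (hqm : AEMeasurable q (volume.restrict (Ici δ)))
    (hq0 : ∀ x, δ ≤ x → 0 ≤ q x) (hq1 : ∀ x, δ ≤ x → q x ≤ 1) {s : ℝ} (hs : 0 < s) :
    laplaceFrom δ (fun x => 1 - q x) s + laplaceFrom δ q s = s⁻¹ * Real.exp (-(s * δ)) := by
  have hi := integrableOn_exp_neg_mul_mul hqm hq0 hq1 hs
  rw [← integral_exp_neg_mul_Ioi hs, laplaceFrom, laplaceFrom, ← integral_add _ hi]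
  · congr 1 with x
    ring
  · have := (integrableOn_exp_neg_mul (δ := δ) hs).sub hi
    refine this.congr (ae_of_all _ fun x => ?_)
    simp only [Pi.sub_apply]
    ring

theorem laplaceFrom_nonneg (hq0 : ∀ x, δ ≤ x → 0 ≤ q x) (s : ℝ) : 0 ≤ laplaceFrom δ q s :=
  setIntegral_nonneg measurableSet_Ioi fun x hx =>
    mul_nonneg (Real.exp_pos _).le (hq0 x (mem_Ioi.1 hx).le)

theorem laplaceFrom_le (hqm : AEMeasurable q (volume.restrict (Ici δ)))
    (hq0 : ∀ x, δ ≤ x → 0 ≤ q x) (hq1 : ∀ x, δ ≤ x → q x ≤ 1) {s : ℝ} (hs : 0 < s) :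
    laplaceFrom δ q s ≤ s⁻¹ * Real.exp (-(s * δ)) := by
  have h := laplaceFrom_nonneg (q := fun x => 1 - q x) (fun x hx => sub_nonneg.2 (hq1 x hx)) s
  linarith [laplaceFrom_one_sub_add hqm hq0 hq1 hs]

/-- Joint measurability in `(s, x)` needs a Borel version of `q`; changing `q` on a null set leaves
every integral unchanged. -/
theorem measurable_laplaceFrom (hqm : AEMeasurable q (volume.restrict (Ici δ))) :
    Measurable (laplaceFrom δ q) := by
  have hq' := hqm.mono_measure (Measure.restrict_mono Ioi_subset_Ici_self le_rfl)
  have e : laplaceFrom δ q = fun s => ∫ x in Ioi δ, Real.exp (-(s * x)) * hq'.mk q x := by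
    ext s
    refine integral_congr_ae ?_
    filter_upwards [hq'.ae_eq_mk] with x hx
    rw [hx]
  rw [e]
  have hm : Measurable fun p : ℝ × ℝ => Real.exp (-(p.1 * p.2)) * hq'.mk q p.2 := by
    have := hq'.measurable_mk
    fun_prop
  exact (hm.stronglyMeasurable.integral_prod_right (ν := volume.restrict (Ioi δ))).measurable

/-- The representing measure is `q(x) dx` on `(δ, ∞)`; as `δ > 0`, restricting it to `(0, ∞)`
changes nothing. -/
theorem isLaplaceOfMeasure_laplaceFrom (hδ : 0 < δ) (hqm : AEMeasurable q (volume.restrict (Ici δ)))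
    (hq0 : ∀ x, δ ≤ x → 0 ≤ q x) (hq1 : ∀ x, δ ≤ x → q x ≤ 1) :
    IsLaplaceOfMeasure (laplaceFrom δ q) := by
  have hq' := hqm.mono_measure (Measure.restrict_mono Ioi_subset_Ici_self le_rfl)
  have hμ : ((volume.restrict (Ioi δ)).withDensity fun x => ENNReal.ofReal (q x)).restrict (Ioi 0) =
      (volume.restrict (Ioi δ)).withDensity fun x => ENNReal.ofReal (q x) := by
    rw [restrict_withDensity measurableSet_Ioi, Measure.restrict_restrict measurableSet_Ioi,
      inter_eq_right.2 (Ioi_subset_Ioi hδ.le)]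
  have hq0' : ∀ᵐ x ∂volume.restrict (Ioi δ), 0 ≤ q x := by
    filter_upwards [ae_restrict_mem measurableSet_Ioi] with x hx using hq0 x (mem_Ioi.1 hx).le
  refine ⟨(volume.restrict (Ioi δ)).withDensity fun x => ENNReal.ofReal (q x), fun s hs => ?_⟩
  rw [IntegrableOn, hμ]
  have hf : AEMeasurable (fun x => ENNReal.ofReal (q x)) (volume.restrict (Ioi δ)) :=
    hq'.ennreal_ofReal
  have htop : ∀ᵐ x ∂volume.restrict (Ioi δ), ENNReal.ofReal (q x) < ⊤ := by simp
  constructor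
  · rw [integrable_withDensity_iff_integrable_smul₀' hf htop]
    refine Integrable.congr (integrableOn_exp_neg_mul_mul hqm hq0 hq1 hs) ?_
    filter_upwards [hq0'] with x hx
    rw [ENNReal.toReal_ofReal hx, smul_eq_mul, mul_comm]
  · rw [integral_withDensity_eq_integral_toReal_smul₀ hf htop, laplaceFrom]
    refine integral_congr_ae ?_
    filter_upwards [hq0'] with x hx
    rw [ENNReal.toReal_ofReal hx, smul_eq_mul, mul_comm]

end LaplaceFrom

/-! ### Sums of independent subordinators. -/

section Sums

variable {Ω : Type*} [MeasurableSpace Ω] {P : Measure Ω} [IsProbabilityMeasure P]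

/-- The componentwise sum of two independent vectors with independent components has independent
components. -/
theorem iIndepFun_add {ι : Type*} [Fintype ι] {U V : ι → Ω → ℝ} (mU : ∀ i, Measurable (U i))
    (mV : ∀ i, Measurable (V i)) (hU : iIndepFun U P) (hV : iIndepFun V P)
    (hUV : IndepFun (fun ω i => U i ω) (fun ω i => V i ω) P) :
    iIndepFun (fun i ω => U i ω + V i ω) P := by
  have hi : ∀ i, IndepFun (U i) (V i) P := fun i =>
    hUV.comp (measurable_pi_apply i) (measurable_pi_apply i)
  -- Characteristic functions of vectors need the Euclidean inner product, hence the passage through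
  -- `WithLp 2`.
  have hLp : Measurable fun x : ι → ℝ => WithLp.toLp 2 x := by fun_prop
  refine (iIndepFun_iff_charFun_pi fun i => ((mU i).add (mV i)).aemeasurable).2 fun t => ?_
  have h := hUV.comp hLp hLp
  have := h.charFun_map_fun_add_eq_mul (by fun_prop) (by fun_prop)
  simp only [Function.comp_def, ← WithLp.toLp_add] at this
  change charFun (P.map fun ω => WithLp.toLp 2 ((fun i => U i ω) + fun i => V i ω)) t = _
  rw [this, Pi.mul_apply, (iIndepFun_iff_charFun_pi fun i => (mU i).aemeasurable).1 hU,
    (iIndepFun_iff_charFun_pi fun i => (mV i).aemeasurable).1 hV, ← Finset.prod_mul_distrib]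
  refine Finset.prod_congr rfl fun i _ => ?_
  rw [(hi i).charFun_map_add_eq_mul (mU i).aemeasurable (mV i).aemeasurable, Pi.mul_apply]

omit [IsProbabilityMeasure P] in
theorem IsSubordinator.ae_nonneg {X : ℝ≥0 → Ω → ℝ} (hX : IsSubordinator X P) :
    ∀ᵐ ω ∂P, ∀ t, 0 ≤ X t ω := by
  filter_upwards [hX.zero, hX.monotone] with ω h0 hm t
  exact h0 ▸ hm zero_le

/-- Path properties are preserved pathwise. Increments are measurable functionals of the path, so
independence of the paths gives independence of the increment vectors, and laws of sums are
convolutions. -/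
theorem IsSubordinator.add {X Y : ℝ≥0 → Ω → ℝ} (hX : IsSubordinator X P)
    (hY : IsSubordinator Y P) (h : IndepProcesses Y X P) :
    IsSubordinator (fun t ω => Y t ω + X t ω) P where
  measurable t := (hY.measurable t).add (hX.measurable t)
  zero := by
    filter_upwards [hX.zero, hY.zero] with ω h1 h2
    rw [h1, h2, add_zero]
  monotone := by
    filter_upwards [hX.monotone, hY.monotone] with ω h1 h2
    exact h2.add h1
  rightContinuous := by
    filter_upwards [hX.rightContinuous, hY.rightContinuous] with ω h1 h2 t
    exact (h2 t).add (h1 t)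
  indepIncrements n t ht := by
    have hφ : Measurable fun (x : ℝ≥0 → ℝ) (i : Fin n) => x (t i.succ) - x (t i.castSucc) := by
      fun_prop
    have := iIndepFun_add (fun i => (hY.measurable _).sub (hY.measurable _))
      (fun i => (hX.measurable _).sub (hX.measurable _)) (hY.indepIncrements n t ht)
      (hX.indepIncrements n t ht) (h.comp hφ hφ)
    convert! this using 3
    simp only [Pi.sub_apply]
    ring
  stationary s t := by
    refine ⟨(((hY.measurable _).add (hX.measurable _)).sub
      ((hY.measurable _).add (hX.measurable _))).aemeasurable,
      ((hY.measurable _).add (hX.measurable _)).aemeasurable, ?_⟩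
    have hφ : Measurable fun x : ℝ≥0 → ℝ => x (s + t) - x s := by fun_prop
    have h1 := (h.comp hφ hφ).map_add_eq_map_conv_map
      ((hY.measurable _).sub (hY.measurable _)) ((hX.measurable _).sub (hX.measurable _))
    have h2 := (h.comp (measurable_pi_apply t) (measurable_pi_apply t)).map_add_eq_map_conv_map
      (hY.measurable _) (hX.measurable _)
    have e1 := (hX.stationary s t).map_eq
    have e2 := (hY.stationary s t).map_eq
    have e : (fun ω => Y (s + t) ω + X (s + t) ω - (Y s ω + X s ω)) =
        Y (s + t) - Y s + (X (s + t) - X s) := by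
      ext ω; simp only [Pi.add_apply, Pi.sub_apply]; ring
    rw [e]
    refine h1.trans (Eq.trans ?_ h2.symm)
    exact congrArg₂ _ e2 e1

/-- A subordinator has the law of a gamma subordinator if its Laplace transforms are right. -/
theorem IsSubordinator.isGammaSubordinator {G : ℝ≥0 → Ω → ℝ} (hG : IsSubordinator G P) {δ : ℝ}
    (hδ : 0 < δ) (h : ∀ t : ℝ≥0, ∀ w : ℝ, 0 < w →
      ∫ ω, Real.exp (-(w * G t ω)) ∂P = Real.exp (-(t * Real.log ((δ + w) / δ)))) :
    IsGammaSubordinator δ G P where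
  isSubordinator := hG
  gamma t ht := by
    have hd : Measurable fun x : ℝ => x / δ := by fun_prop
    have mG := hG.measurable t
    have hp : IsProbabilityMeasure (gammaMeasure t 1) :=
      isProbabilityMeasure_gammaMeasure (by exact_mod_cast ht) one_pos
    have := Measure.isProbabilityMeasure_map (μ := P) mG.aemeasurable
    have := Measure.isProbabilityMeasure_map (μ := gammaMeasure t 1) hd.aemeasurable
    have h0 : ∀ᵐ x ∂gammaMeasure t 1, 0 ≤ x := by
      rw [ae_iff, gammaMeasure, show {a : ℝ | ¬ 0 ≤ a} = Iio 0 by ext; simp,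
        withDensity_apply _ measurableSet_Iio, lintegral_gammaPDF_of_nonpos le_rfl]
    refine ⟨mG.aemeasurable, hd.aemeasurable, ext_of_laplace_eq ?_ ?_ fun w hw => ?_⟩
    · rw [ae_map_iff mG.aemeasurable measurableSet_Ici]
      exact hG.ae_nonneg.mono fun ω h => h t
    · rw [ae_map_iff hd.aemeasurable measurableSet_Ici]
      exact h0.mono fun x hx => div_nonneg hx hδ.le
    · rw [integral_map mG.aemeasurable (by fun_prop), integral_map hd.aemeasurable (by fun_prop),
        h t w hw, integral_exp_neg_mul_div_gammaMeasure (by exact_mod_cast ht) hδ hw]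

theorem IsGammaSubordinator.hasLevyDensity {G : ℝ≥0 → Ω → ℝ} {δ : ℝ} (hδ : 0 < δ)
    (hG : IsGammaSubordinator δ G P) :
    HasLevyDensity G P fun s => s⁻¹ * Real.exp (-(s * δ)) where
  nonneg s hs := by positivity
  integrable w hw := integrableOn_gamma_levy hδ hw
  laplace t w hw := by
    rw [integral_gamma_levy hδ hw]
    -- The gamma marginals are prescribed only for `t > 0`; time `0` uses that the process starts at
    -- `0`.
    rcases eq_zero_or_pos t with rfl | ht
    · rw [integral_congr_ae (g := fun _ => 1)]
      · simp
      · filter_upwards [hG.isSubordinator.zero] with ω h0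
        simp [h0]
    · have h := (hG.gamma t ht).comp (u := fun x : ℝ => Real.exp (-(w * x))) (by fun_prop)
      have := h.integral_eq
      simp only [Function.comp_def] at this
      rw [this, integral_exp_neg_mul_div_gammaMeasure (by exact_mod_cast ht) hδ hw]

/-- By independence the Laplace transforms multiply, so the exponents add; the densities sum to the
gamma density, whose exponent is known. -/
theorem isGammaSubordinator_add {δ : ℝ} {q : ℝ → ℝ} (hδ : 0 < δ)
    (hqm : AEMeasurable q (volume.restrict (Ici δ)))
    (hq0 : ∀ x, δ ≤ x → 0 ≤ q x) (hq1 : ∀ x, δ ≤ x → q x ≤ 1) {X Y : ℝ≥0 → Ω → ℝ}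
    (hX : IsBSubordinator X P (laplaceFrom δ q))
    (hY : IsBSubordinator Y P (laplaceFrom δ fun x => 1 - q x)) (h : IndepProcesses X Y P) :
    IsGammaSubordinator δ (fun t ω => Y t ω + X t ω) P := by
  have h' : IndepProcesses Y X P := IndepFun.symm h
  refine (hX.isSubordinator.add hY.isSubordinator h').isGammaSubordinator hδ fun t w hw => ?_
  have hφ : Measurable fun x : ℝ≥0 → ℝ => Real.exp (-(w * x t)) := by fun_prop
  have mX := hX.isSubordinator.measurable t
  have mY := hY.isSubordinator.measurable t
  have := (h'.comp hφ hφ).integral_mul_eq_mul_integral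
    (by simp only [Function.comp_def]; fun_prop) (by simp only [Function.comp_def]; fun_prop)
  simp only [Function.comp_def, Pi.mul_def] at this
  simp_rw [mul_add, neg_add, Real.exp_add]
  rw [this, hX.hasLevyDensity.laplace t w hw, hY.hasLevyDensity.laplace t w hw, ← Real.exp_add,
    ← integral_gamma_levy hδ hw, ← neg_add, ← mul_add,
    ← integral_add (hY.hasLevyDensity.integrable w hw) (hX.hasLevyDensity.integrable w hw)]
  congr 3
  refine setIntegral_congr_fun measurableSet_Ioi fun s hs => ?_
  rw [← laplaceFrom_one_sub_add hqm hq0 hq1 hs]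
  ring

end Sums

/-! ### Lifting processes along measure-preserving maps, such as the projections of a product. -/

section Transport

variable {Ω Ω' : Type*} [MeasurableSpace Ω] [MeasurableSpace Ω'] {P : Measure Ω} {Q : Measure Ω'}

theorem IsSubordinator.comp_measurePreserving {X : ℝ≥0 → Ω → ℝ} (hX : IsSubordinator X P)
    [IsProbabilityMeasure Q] {f : Ω' → Ω} (hf : MeasurePreserving f Q P) :
    IsSubordinator (fun t ω => X t (f ω)) Q where
  measurable t := (hX.measurable t).comp hf.measurable
  zero := hf.quasiMeasurePreserving.ae hX.zero
  monotone := hf.quasiMeasurePreserving.ae hX.monotone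
  rightContinuous := hf.quasiMeasurePreserving.ae hX.rightContinuous
  indepIncrements n t ht := by
    have hP : IsProbabilityMeasure P := hf.map_eq ▸ Measure.isProbabilityMeasure_map hf.aemeasurable
    have mX : ∀ i : Fin n, Measurable fun ω => X (t i.succ) ω - X (t i.castSucc) ω := fun i =>
      (hX.measurable _).sub (hX.measurable _)
    have h := (iIndepFun_iff_map_fun_eq_pi_map fun i => (mX i).aemeasurable).1
      (hX.indepIncrements n t ht)
    refine (iIndepFun_iff_map_fun_eq_pi_map
      fun i => ((mX i).comp hf.measurable).aemeasurable).2 ?_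
    have e : ∀ i : Fin n, Q.map ((fun ω => X (t i.succ) ω - X (t i.castSucc) ω) ∘ f) =
        P.map fun ω => X (t i.succ) ω - X (t i.castSucc) ω := fun i => by
      rw [← Measure.map_map (mX i) hf.measurable, hf.map_eq]
    simp only [Function.comp_def] at e ⊢
    simp_rw [e, ← h, ← hf.map_eq]
    rw [Measure.map_map (measurable_pi_lambda _ mX) hf.measurable]
    rfl
  stationary s t := by
    have m1 := (hX.measurable (s + t)).sub (hX.measurable s)
    refine ⟨(m1.comp hf.measurable).aemeasurable,
      ((hX.measurable t).comp hf.measurable).aemeasurable, ?_⟩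
    have h := (hX.stationary s t).map_eq
    rw [← hf.map_eq, Measure.map_map (hX.measurable t) hf.measurable] at h
    exact (Measure.map_map m1 hf.measurable).symm.trans h

theorem IsBSubordinator.comp_measurePreserving {X : ℝ≥0 → Ω → ℝ} {ρ : ℝ → ℝ}
    (hX : IsBSubordinator X P ρ) [IsProbabilityMeasure Q] {f : Ω' → Ω}
    (hf : MeasurePreserving f Q P) : IsBSubordinator (fun t ω => X t (f ω)) Q ρ where
  isSubordinator := hX.isSubordinator.comp_measurePreserving hf
  completelyMonotone := hX.completelyMonotone
  hasLevyDensity :=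
    { nonneg := hX.hasLevyDensity.nonneg
      integrable := hX.hasLevyDensity.integrable
      laplace := fun t w hw => by
        have mX := hX.isSubordinator.measurable t
        rw [← hX.hasLevyDensity.laplace t w hw, ← hf.map_eq,
          integral_map hf.aemeasurable (by fun_prop)] }

end Transport

/-! ### Sums over Poisson point processes. -/

section PoissonSums

open Filter Topology
open scoped ENNReal

/-- An s-finite measure is a sum of finite pieces, each of which can be normalised; a zero piece
gets weight `0` and an arbitrary Dirac mass. Each term will be the intensity of one cluster. -/
theorem exists_eq_sum_smul_probability {E : Type*} [MeasurableSpace E] [Nonempty E]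
    (lam : Measure E) [SFinite lam] :
    ∃ (c : ℕ → ℝ≥0) (p : ℕ → Measure E), (∀ m, IsProbabilityMeasure (p m)) ∧
      lam = Measure.sum fun m => c m • p m := by
  have key : ∀ m, ∃ (c : ℝ≥0) (p : Measure E), IsProbabilityMeasure p ∧
      sfiniteSeq lam m = c • p := by
    intro m
    by_cases h : sfiniteSeq lam m = 0
    · obtain ⟨x⟩ := ‹Nonempty E›
      exact ⟨0, Measure.dirac x, inferInstance, by rw [h, zero_smul]⟩
    · have h0 : sfiniteSeq lam m univ ≠ 0 := by simpa using h
      refine ⟨(sfiniteSeq lam m univ).toNNReal, (sfiniteSeq lam m univ)⁻¹ • sfiniteSeq lam m,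
        ⟨?_⟩, ?_⟩
      · rw [Measure.smul_apply, smul_eq_mul, ENNReal.inv_mul_cancel h0 (measure_ne_top _ _)]
      · ext s _
        rw [Measure.smul_apply, Measure.smul_apply, ENNReal.smul_def, smul_eq_mul, smul_eq_mul,
          ENNReal.coe_toNNReal (measure_ne_top _ _), ← mul_assoc,
          ENNReal.mul_inv_cancel h0 (measure_ne_top _ _), one_mul]
  choose c p hp h using key
  exact ⟨c, p, hp, by simp_rw [← h, sum_sfiniteSeq]⟩

/-- The law of a Poisson number of points, together with an infinite supply of i.i.d. points. -/
noncomputable def poissonClusterMeasure {E : Type*} [MeasurableSpace E] (c : ℝ≥0) (p : Measure E) :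
    Measure (ℕ × (ℕ → E)) :=
  (poissonMeasure c).prod (Measure.infinitePi fun _ => p)

/-- The sum of `f` over the points of a finite cluster. -/
def clusterSum {E M : Type*} [AddCommMonoid M] (f : E → M) (ω : ℕ × (ℕ → E)) : M :=
  ∑ i ∈ Finset.range ω.1, f (ω.2 i)

/-- The sum of `f` over the points of countably many clusters. -/
noncomputable def pointSum {E M : Type*} [AddCommMonoid M] [TopologicalSpace M] (f : E → M)
    (ω : ℕ → ℕ × (ℕ → E)) : M :=
  ∑' m, clusterSum f (ω m)

variable {E : Type*} [MeasurableSpace E]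

@[fun_prop]
theorem measurable_clusterSum {M : Type*} [AddCommMonoid M] [MeasurableSpace M] [MeasurableAdd₂ M]
    {f : E → M} (hf : Measurable f) : Measurable (clusterSum f) := by
  refine measurable_from_prod_countable_right fun n => ?_
  exact Finset.measurable_fun_sum (f := fun i (y : ℕ → E) => f (y i)) (Finset.range n)
    fun i _ => hf.comp (measurable_pi_apply i)

instance (c : ℝ≥0) (p : Measure E) [IsProbabilityMeasure p] :
    IsProbabilityMeasure (poissonClusterMeasure c p) := by
  unfold poissonClusterMeasure; infer_instance

theorem lintegral_natCast_poissonMeasure (c : ℝ≥0) :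
    ∫⁻ n : ℕ, (n : ℝ≥0∞) ∂poissonMeasure c = c := by
  have e : ∀ n : ℕ, ENNReal.ofReal (Real.exp (-c) * c ^ (n + 1) / (n + 1).factorial) *
      ((n + 1 : ℕ) : ℝ≥0∞) = c * ENNReal.ofReal (Real.exp (-c) * c ^ n / n.factorial) := by
    intro n
    rw [← ENNReal.ofReal_natCast, ← ENNReal.ofReal_mul (by positivity),
      ← ENNReal.ofReal_coe_nnreal (p := c), ← ENNReal.ofReal_mul (by positivity),
      Nat.factorial_succ]
    congr 1
    push_cast
    field_simp
    ring
  rw [poissonMeasure, lintegral_sum_measure]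
  simp_rw [lintegral_smul_measure, lintegral_dirac, smul_eq_mul]
  -- The term `n = 0` vanishes; after the shift, `n + 1` cancels against the factorial and `c` times
  -- the total mass remains.
  rw [tsum_eq_zero_add' ENNReal.summable]
  simp_rw [e]
  rw [ENNReal.tsum_mul_left, ← ENNReal.ofReal_tsum_of_nonneg (fun n => by positivity)
    (hasSum_one_poissonMeasure c).summable, (hasSum_one_poissonMeasure c).tsum_eq]
  simp

/-- Wald's identity: given the number of points, the mean is that number times the mean of `f`. -/
theorem lintegral_clusterSum (c : ℝ≥0) (p : Measure E) [IsProbabilityMeasure p] {f : E → ℝ≥0∞}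
    (hf : Measurable f) :
    ∫⁻ ω, clusterSum f ω ∂poissonClusterMeasure c p = c * ∫⁻ x, f x ∂p := by
  rw [poissonClusterMeasure, lintegral_prod _ (by fun_prop)]
  have e : ∀ n : ℕ, ∫⁻ x, clusterSum f (n, x) ∂(Measure.infinitePi fun _ : ℕ => p) =
      n * ∫⁻ x, f x ∂p := by
    intro n
    simp only [clusterSum]
    rw [lintegral_finsetSum (f := fun i (x : ℕ → E) => f (x i)) _
      fun i _ => hf.comp (measurable_pi_apply i)]
    have : ∀ i : ℕ, ∫⁻ x : ℕ → E, f (x i) ∂(Measure.infinitePi fun _ : ℕ => p) =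
        ∫⁻ x, f x ∂p := fun i =>
      (measurePreserving_eval_infinitePi (fun _ : ℕ => p) i).lintegral_comp hf
    simp [this]
  simp_rw [e]
  rw [lintegral_mul_const _ (by fun_prop), lintegral_natCast_poissonMeasure]

theorem norm_exp_le_one {z : ℂ} (hz : z.re ≤ 0) : ‖Complex.exp z‖ ≤ 1 := by
  rw [Complex.norm_exp]; exact Real.exp_le_one_iff.2 hz

/-- A linear bound valid on the whole left half-plane makes `exp g - 1` integrable together with
`g`, even for an infinite intensity. -/
theorem norm_exp_sub_one_le_of_re_nonpos {z : ℂ} (hz : z.re ≤ 0) :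
    ‖Complex.exp z - 1‖ ≤ 2 * ‖z‖ := by
  by_cases h : ‖z‖ ≤ 1
  · exact Complex.norm_exp_sub_one_le h
  · calc ‖Complex.exp z - 1‖ ≤ ‖Complex.exp z‖ + ‖(1 : ℂ)‖ := norm_sub_le _ _
      _ ≤ 1 + 1 := by gcongr; exacts [norm_exp_le_one hz, by simp]
      _ ≤ 2 * ‖z‖ := by linarith

theorem integrable_exp_sub_one {lam : Measure E} {g : E → ℂ} (hg : Integrable g lam)
    (hre : ∀ x, (g x).re ≤ 0) : Integrable (fun x => Complex.exp (g x) - 1) lam := by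
  refine (hg.norm.const_mul 2).mono' ?_ (ae_of_all _ fun x =>
    norm_exp_sub_one_le_of_re_nonpos (hre x))
  exact ((Complex.continuous_exp.comp_aestronglyMeasurable hg.1).sub aestronglyMeasurable_const)

omit [MeasurableSpace E] in
theorem re_clusterSum_nonpos {g : E → ℂ} (hre : ∀ x, (g x).re ≤ 0) (ω : ℕ × (ℕ → E)) :
    (clusterSum g ω).re ≤ 0 := by
  rw [clusterSum, Complex.re_sum]
  exact Finset.sum_nonpos fun i _ => hre _

/-- Given `n` points, independence yields the `n`-th power of a single integral; averaging over `n`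
is the Poisson generating function `exp (c * (z - 1))`. -/
theorem integral_exp_clusterSum (c : ℝ≥0) (p : Measure E) [IsProbabilityMeasure p] {g : E → ℂ}
    (hg : Measurable g) (hre : ∀ x, (g x).re ≤ 0) :
    ∫ ω, Complex.exp (clusterSum g ω) ∂poissonClusterMeasure c p =
      Complex.exp (c * ∫ x, (Complex.exp (g x) - 1) ∂p) := by
  have hint : Integrable (fun x => Complex.exp (g x)) p :=
    Integrable.of_bound (by fun_prop) 1 (ae_of_all _ fun x => norm_exp_le_one (hre x))
  have hint' : Integrable (fun ω => Complex.exp (clusterSum g ω)) (poissonClusterMeasure c p) :=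
    Integrable.of_bound (by fun_prop) 1
      (ae_of_all _ fun ω => norm_exp_le_one (re_clusterSum_nonpos hre ω))
  rw [poissonClusterMeasure] at hint' ⊢
  rw [integral_prod _ hint']
  have e : ∀ n : ℕ, ∫ x, Complex.exp (clusterSum g (n, x)) ∂(Measure.infinitePi fun _ : ℕ => p) =
      (∫ x, Complex.exp (g x) ∂p) ^ n := by
    intro n
    have hind : iIndepFun (fun (i : Fin n) (x : ℕ → E) => Complex.exp (g (x i)))
        (Measure.infinitePi fun _ : ℕ => p) :=
      (iIndepFun_infinitePi (P := fun _ : ℕ => p) (X := fun _ x => Complex.exp (g x))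
        (fun _ => by fun_prop)).precomp Fin.val_injective
    have h := hind.integral_fun_prod_eq_prod_integral fun i =>
      (by fun_prop : Measurable _).aestronglyMeasurable
    have h2 : ∀ i : Fin n, ∫ x : ℕ → E, Complex.exp (g (x i)) ∂(Measure.infinitePi fun _ : ℕ => p) =
        ∫ x, Complex.exp (g x) ∂p := fun i => by
      have mp := measurePreserving_eval_infinitePi (fun _ : ℕ => p) (i : ℕ)
      conv_rhs => rw [← mp.map_eq]
      rw [integral_map mp.aemeasurable (by fun_prop)]
    simp_rw [h2] at h
    simp only [Finset.prod_const, Finset.card_univ, Fintype.card_fin] at h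
    rw [← h]
    congr 1 with x
    rw [clusterSum, Complex.exp_sum, Finset.prod_range]
  simp_rw [e]
  rw [integral_poissonMeasure, integral_sub hint (integrable_const _)]
  set z := ∫ x, Complex.exp (g x) ∂p
  have hs := ((NormedSpace.expSeries_div_hasSum_exp ((c : ℂ) * z)).mul_left
    (Complex.exp (-c))).tsum_eq
  rw [← Complex.exp_eq_exp_ℂ, ← Complex.exp_add] at hs
  have e1 : ∫ _x : E, (1 : ℂ) ∂p = 1 := by simp
  rw [e1, show (c : ℂ) * (z - 1) = -c + c * z by ring, ← hs]
  congr 1 with n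
  rw [Complex.real_smul]
  push_cast
  ring

variable {c : ℕ → ℝ≥0} {p : ℕ → Measure E} [∀ m, IsProbabilityMeasure (p m)]

/-- The law of countably many independent Poisson clusters. Their union is a Poisson point process
with intensity `∑ m, c m • p m`. -/
noncomputable def poissonClustersMeasure (c : ℕ → ℝ≥0) (p : ℕ → Measure E)
    [∀ m, IsProbabilityMeasure (p m)] : Measure (ℕ → ℕ × (ℕ → E)) :=
  Measure.infinitePi fun m => poissonClusterMeasure (c m) (p m)

instance : IsProbabilityMeasure (poissonClustersMeasure c p) := by
  unfold poissonClustersMeasure; infer_instance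

/-- Campbell's formula. -/
theorem lintegral_pointSum {f : E → ℝ≥0∞} (hf : Measurable f) :
    ∫⁻ ω, pointSum f ω ∂poissonClustersMeasure c p =
      ∫⁻ x, f x ∂Measure.sum fun m => c m • p m := by
  unfold pointSum
  rw [lintegral_tsum fun m => (by fun_prop : Measurable _).aemeasurable, lintegral_sum_measure]
  congr 1 with m
  rw [lintegral_smul_measure, ENNReal.smul_def, smul_eq_mul, ← lintegral_clusterSum _ _ hf]
  exact (measurePreserving_eval_infinitePi (fun m => poissonClusterMeasure (c m) (p m))
    m).lintegral_comp (by fun_prop)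

/-- Campbell's formula applied to `‖g‖ₑ` gives the sum of norms a finite mean, so it is almost
surely finite. -/
theorem ae_summable_clusterSum {F : Type*} [NormedAddCommGroup F] [CompleteSpace F]
    [MeasurableSpace F] [BorelSpace F] {g : E → F} (hm : Measurable g)
    (hg : Integrable g (Measure.sum fun m => c m • p m)) :
    ∀ᵐ ω ∂poissonClustersMeasure c p, Summable fun m => clusterSum g (ω m) := by
  have hfin : ∫⁻ ω, pointSum (fun x => ‖g x‖ₑ) ω ∂poissonClustersMeasure c p ≠ ∞ := by
    rw [lintegral_pointSum hm.enorm]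
    exact hg.2.ne
  have hmeas : Measurable (pointSum fun x => ‖g x‖ₑ) := by
    unfold pointSum
    have := hm.enorm
    exact Measurable.tsum fun m => by fun_prop
  filter_upwards [ae_lt_top hmeas hfin] with ω hω
  refine Summable.of_norm ?_
  have hle : ∀ m, ‖clusterSum g (ω m)‖ₑ ≤ clusterSum (fun x => ‖g x‖ₑ) (ω m) := fun m =>
    enorm_sum_le _ _
  have h : ∑' m, ‖clusterSum g (ω m)‖ₑ ≠ ∞ :=
    ((ENNReal.tsum_le_tsum hle).trans_lt hω).ne
  have := ENNReal.summable_toReal h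
  simpa using this

/-- The exponential formula for Poisson point processes. -/
theorem integral_exp_pointSum {g : E → ℂ} (hm : Measurable g)
    (hg : Integrable g (Measure.sum fun m => c m • p m)) (hre : ∀ x, (g x).re ≤ 0) :
    ∫ ω, Complex.exp (pointSum g ω) ∂poissonClustersMeasure c p =
      Complex.exp (∫ x, (Complex.exp (g x) - 1) ∂Measure.sum fun m => c m • p m) := by
  -- Nonpositive real parts bound all the exponentials by `1`, so finitely many clusters suffice;
  -- for these, independence turns the integral into a product.
  have hlim : Tendsto (fun M : ℕ => ∫ ω, Complex.exp (∑ m ∈ Finset.range M, clusterSum g (ω m))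
      ∂poissonClustersMeasure c p) atTop
      (𝓝 (∫ ω, Complex.exp (pointSum g ω) ∂poissonClustersMeasure c p)) := by
    refine tendsto_integral_of_dominated_convergence (fun _ => 1) (fun M => ?_)
      (integrable_const _) (fun M => ae_of_all _ fun ω => ?_) ?_
    · exact (by fun_prop : Measurable _).aestronglyMeasurable
    · refine norm_exp_le_one ?_
      rw [Complex.re_sum]
      exact Finset.sum_nonpos fun m _ => re_clusterSum_nonpos hre _
    · filter_upwards [ae_summable_clusterSum hm hg] with ω hω
      exact (Complex.continuous_exp.tendsto _).comp hω.hasSum.tendsto_sum_nat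
  have hsum := (hasSum_integral_measure (integrable_exp_sub_one hg hre)).tendsto_sum_nat
  refine tendsto_nhds_unique hlim (((Complex.continuous_exp.tendsto _).comp hsum).congr fun M => ?_)
  have hind : iIndepFun (fun (m : Fin M) (ω : ℕ → ℕ × (ℕ → E)) =>
      Complex.exp (clusterSum g (ω m))) (poissonClustersMeasure c p) :=
    (iIndepFun_infinitePi (P := fun m => poissonClusterMeasure (c m) (p m))
      (X := fun _ x => Complex.exp (clusterSum g x))
      (fun _ => by fun_prop)).precomp Fin.val_injective
  have h := hind.integral_fun_prod_eq_prod_integral fun i =>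
      (by fun_prop : Measurable _).aestronglyMeasurable
  simp only [Function.comp_apply, Complex.exp_sum]
  rw [Finset.prod_range]
  simp_rw [Finset.prod_range]
  rw [h]
  refine Finset.prod_congr rfl fun m _ => ?_
  have mp := measurePreserving_eval_infinitePi (fun m => poissonClusterMeasure (c m) (p m)) (m : ℕ)
  rw [integral_smul_nnreal_measure, NNReal.smul_def, Complex.real_smul,
    ← integral_exp_clusterSum _ _ hm hre]
  conv_lhs => rw [← mp.map_eq]
  rw [integral_map mp.aemeasurable (by fun_prop)]
  rfl

end PoissonSums

/-! ### The subordinator as a sum of Poissonian jumps. -/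

section PoissonSubordinator

open Filter Topology
open scoped ENNReal

/-- The point `(u, s)`, a jump of size `s` at time `u`, contributes `s` if it falls into the time
interval `(a, b]`. -/
noncomputable def jump (a b : ℝ≥0) (x : ℝ × ℝ≥0) : ℝ :=
  (Ioc (a : ℝ) b).indicator 1 x.1 * x.2

@[fun_prop]
theorem measurable_jump (a b : ℝ≥0) : Measurable (jump a b) := by
  have : Measurable ((Ioc (a : ℝ) b).indicator (1 : ℝ → ℝ)) :=
    measurable_one.indicator measurableSet_Ioc
  unfold jump
  fun_prop

theorem jump_nonneg (a b : ℝ≥0) (x : ℝ × ℝ≥0) : 0 ≤ jump a b x :=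
  mul_nonneg (indicator_nonneg (fun _ _ => zero_le_one) _) x.2.2

theorem jump_add_jump {a b c : ℝ≥0} (hab : a ≤ b) (hbc : b ≤ c) (x : ℝ × ℝ≥0) :
    jump a b x + jump b c x = jump a c x := by
  have hab' : (a : ℝ) ≤ b := hab
  have hbc' : (b : ℝ) ≤ c := hbc
  rw [jump, jump, jump, ← add_mul, ← Ioc_union_Ioc_eq_Ioc hab' hbc',
    indicator_union_of_disjoint (Ioc_disjoint_Ioc_of_le le_rfl)]

theorem jump_mono {b c : ℝ≥0} (hbc : b ≤ c) (x : ℝ × ℝ≥0) : jump 0 b x ≤ jump 0 c x := by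
  rw [← jump_add_jump zero_le hbc]
  exact le_add_of_nonneg_right (jump_nonneg _ _ _)

/-- A jump at a time `≤ t` has a constant contribution from `t` on, one at a later time contributes
`0` just after `t`; this is where the intervals must be closed on the right. -/
theorem continuousWithinAt_jump (x : ℝ × ℝ≥0) (t : ℝ≥0) :
    ContinuousWithinAt (fun b => jump 0 b x) (Ici t) t := by
  rcases le_or_gt x.1 t with h | h
  · refine (continuousWithinAt_const (b := jump 0 t x)).congr (fun b hb => ?_) rfl
    have hb : (t : ℝ) ≤ b := hb
    by_cases h0 : 0 < x.1
    · simp [jump, indicator, h0, h, h.trans hb]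
    · simp [jump, indicator, h0]
  · refine (continuousWithinAt_const (b := (0 : ℝ))).congr_of_eventuallyEq ?_ ?_
    · have : ∀ᶠ b : ℝ≥0 in 𝓝 t, (b : ℝ) < x.1 :=
        (NNReal.continuous_coe.tendsto t).eventually (gt_mem_nhds h)
      filter_upwards [mem_nhdsWithin_of_mem_nhds this] with b hb
      have hb : (b : ℝ) < x.1 := hb
      simp [jump, indicator, not_le.2 hb]
    · simp [jump, indicator, not_le.2 h]

/-- The indicator is `0` or `1`, so it can be pulled out; the integrand then factorises over the
product `volume.prod ν`. -/
theorem exp_mul_jump_sub_one (a b : ℝ≥0) (z : ℂ) (x : ℝ × ℝ≥0) :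
    Complex.exp (z * jump a b x) - 1 =
      (Ioc (a : ℝ) b).indicator 1 x.1 * (Complex.exp (z * x.2) - 1) := by
  by_cases h : x.1 ∈ Ioc (a : ℝ) b <;> simp [jump, h]

/-- Jumps in successive time intervals do not interact. -/
theorem exp_sum_mul_jump_sub_one {n : ℕ} {t : Fin (n + 1) → ℝ≥0} (ht : Monotone t) (z : Fin n → ℂ)
    (x : ℝ × ℝ≥0) :
    Complex.exp (∑ k, z k * jump (t k.castSucc) (t k.succ) x) - 1 =
      ∑ k, (Complex.exp (z k * jump (t k.castSucc) (t k.succ) x) - 1) := by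
  by_cases h : ∃ k : Fin n, x.1 ∈ Ioc (t k.castSucc : ℝ) (t k.succ)
  · obtain ⟨k, hk⟩ := h
    have h0 : ∀ j : Fin n, j ≠ k → jump (t j.castSucc) (t j.succ) x = 0 := by
      intro j hj
      have : x.1 ∉ Ioc (t j.castSucc : ℝ) (t j.succ) := by
        rintro ⟨h1, h2⟩
        rcases lt_or_gt_of_ne hj with hlt | hlt
        · have : (t j.succ : ℝ) ≤ t k.castSucc :=
            NNReal.coe_le_coe.2 (ht (Fin.succ_le_castSucc_iff.2 hlt))
          linarith [hk.1]
        · have : (t k.succ : ℝ) ≤ t j.castSucc :=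
            NNReal.coe_le_coe.2 (ht (Fin.succ_le_castSucc_iff.2 hlt))
          linarith [hk.2]
      simp [jump, this]
    rw [Finset.sum_eq_single k (fun j _ hj => by simp [h0 j hj]) (by simp),
      Finset.sum_eq_single k (fun j _ hj => by simp [h0 j hj]) (by simp)]
  · push Not at h
    have h0 : ∀ j : Fin n, jump (t j.castSucc) (t j.succ) x = 0 := fun j => by simp [jump, h j]
    simp [h0]

variable {ν : Measure ℝ≥0} [SFinite ν]

omit [SFinite ν] in
theorem integrable_jump (hν : Integrable (fun s : ℝ≥0 => (s : ℝ)) ν) (a b : ℝ≥0) :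
    Integrable (jump a b) ((volume : Measure ℝ).prod ν) := by
  unfold jump
  refine Integrable.mul_prod (f := (Ioc (a : ℝ) b).indicator (1 : ℝ → ℝ)) ?_ hν
  exact (integrable_indicator_iff measurableSet_Ioc).2 (integrableOn_const (by simp))

theorem integral_exp_mul_jump_sub_one {a b : ℝ≥0} (hab : a ≤ b) (z : ℂ) :
    ∫ x, (Complex.exp (z * jump a b x) - 1) ∂(volume : Measure ℝ).prod ν =
      ((b - a : ℝ) : ℂ) * ∫ s : ℝ≥0, (Complex.exp (z * s) - 1) ∂ν := by
  simp_rw [exp_mul_jump_sub_one]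
  rw [integral_prod_mul (f := (Ioc (a : ℝ) b).indicator (1 : ℝ → ℂ))
    (g := fun s : ℝ≥0 => Complex.exp (z * s) - 1)]
  congr 1
  have hab' : (0 : ℝ) ≤ b - a := sub_nonneg.2 hab
  rw [integral_indicator measurableSet_Ioc]
  simp [hab']

/-- The process which jumps at the points of a collection of clusters. -/
noncomputable def jumpProcess (t : ℝ≥0) (ω : ℕ → ℕ × (ℕ → ℝ × ℝ≥0)) : ℝ :=
  pointSum (jump 0 t) ω

theorem clusterSum_nonneg {E : Type*} {f : E → ℝ} (hf : ∀ x, 0 ≤ f x) (ω : ℕ × (ℕ → E)) :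
    0 ≤ clusterSum f ω :=
  Finset.sum_nonneg fun _ _ => hf _

theorem measurable_jumpProcess (t : ℝ≥0) : Measurable (jumpProcess t) := by
  -- The identity holds for every `ω`: without summability, the real `tsum` and `toReal` of infinity
  -- are both `0` by convention.
  have e : jumpProcess t = fun ω => (∑' m, ENNReal.ofReal (clusterSum (jump 0 t) (ω m))).toReal := by
    ext ω
    rw [ENNReal.tsum_toReal_eq (by simp)]
    simp only [jumpProcess, pointSum, ENNReal.toReal_ofReal (clusterSum_nonneg (jump_nonneg 0 t) _)]
  rw [e]
  exact (Measurable.tsum fun m => by fun_prop).ennreal_toReal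

variable {ω : ℕ → ℕ × (ℕ → ℝ × ℝ≥0)}

/-- Summability at integer times is a countable family of conditions, hence a single almost sure
event, and it controls all time intervals. -/
theorem summable_clusterSum_jump
    (h : ∀ n : ℕ, Summable fun m => clusterSum (jump 0 n) (ω m)) (a b : ℝ≥0) :
    Summable fun m => clusterSum (jump a b) (ω m) := by
  obtain ⟨n, hn⟩ := exists_nat_ge (max a b)
  have ha : a ≤ n := (le_max_left _ _).trans hn
  have hb : b ≤ n := (le_max_right _ _).trans hn
  refine Summable.of_nonneg_of_le (fun m => clusterSum_nonneg (jump_nonneg a b) _)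
    (fun m => Finset.sum_le_sum fun i _ => ?_) (h n)
  rcases le_total a b with hab | hab
  · refine le_trans ?_ (jump_mono hb _)
    rw [← jump_add_jump zero_le hab]
    exact le_add_of_nonneg_left (jump_nonneg _ _ _)
  · rw [jump, Ioc_eq_empty (by simpa using hab)]
    simpa using jump_nonneg 0 n _

theorem jumpProcess_sub (h : ∀ n : ℕ, Summable fun m => clusterSum (jump 0 n) (ω m)) {a b : ℝ≥0}
    (hab : a ≤ b) : jumpProcess b ω - jumpProcess a ω = pointSum (jump a b) ω := by
  rw [sub_eq_iff_eq_add, jumpProcess, jumpProcess, pointSum, pointSum, pointSum,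
    ← (summable_clusterSum_jump h a b).tsum_add (summable_clusterSum_jump h 0 a)]
  congr 1 with m
  simp_rw [clusterSum]
  rw [← Finset.sum_add_distrib]
  refine Finset.sum_congr rfl fun i _ => ?_
  rw [add_comm, jump_add_jump zero_le hab]

theorem monotone_jumpProcess (h : ∀ n : ℕ, Summable fun m => clusterSum (jump 0 n) (ω m)) :
    Monotone fun t => jumpProcess t ω := by
  intro a b hab
  rw [← sub_nonneg, jumpProcess_sub h hab]
  exact tsum_nonneg fun m => clusterSum_nonneg (jump_nonneg a b) _

theorem continuousWithinAt_jumpProcess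
    (h : ∀ n : ℕ, Summable fun m => clusterSum (jump 0 n) (ω m)) (t : ℝ≥0) :
    ContinuousWithinAt (fun u => jumpProcess u ω) (Ici t) t := by
  -- For `u < t + 1` each cluster sum is dominated by the one up to time `t + 1`.
  refine tendsto_tsum_of_dominated_convergence (summable_clusterSum_jump h 0 (t + 1)) (fun m => ?_) ?_
  · exact tendsto_finsetSum _ fun i _ => continuousWithinAt_jump _ t
  · have : ∀ᶠ u : ℝ≥0 in 𝓝[Ici t] t, u < t + 1 :=
      mem_nhdsWithin_of_mem_nhds (gt_mem_nhds (lt_add_one t))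
    filter_upwards [this] with u hu m
    rw [Real.norm_of_nonneg (clusterSum_nonneg (jump_nonneg 0 u) _)]
    exact Finset.sum_le_sum fun i _ => jump_mono hu.le _

/-- A linear combination of increments is again a sum over the points, so the exponential formula
yields its joint transform. -/
theorem sum_mul_jumpProcess_sub (h : ∀ n : ℕ, Summable fun m => clusterSum (jump 0 n) (ω m)) {n : ℕ}
    {t : Fin (n + 1) → ℝ≥0} (ht : Monotone t) (z : Fin n → ℂ) :
    ∑ k, z k * ((jumpProcess (t k.succ) ω - jumpProcess (t k.castSucc) ω : ℝ) : ℂ) =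
      pointSum (fun x => ∑ k, z k * (jump (t k.castSucc) (t k.succ) x : ℂ)) ω := by
  have e : ∀ m, clusterSum (fun x => ∑ k, z k * (jump (t k.castSucc) (t k.succ) x : ℂ)) (ω m) =
      ∑ k, z k * ((clusterSum (jump (t k.castSucc) (t k.succ)) (ω m) : ℝ) : ℂ) := by
    intro m
    simp_rw [clusterSum]
    rw [Finset.sum_comm]
    refine Finset.sum_congr rfl fun k _ => ?_
    rw [Complex.ofReal_sum, Finset.mul_sum]
  have hs : ∀ k : Fin n, Summable fun m =>
      z k * ((clusterSum (jump (t k.castSucc) (t k.succ)) (ω m) : ℝ) : ℂ) := fun k =>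
    (Complex.hasSum_ofReal.2 (summable_clusterSum_jump h _ _).hasSum).summable.mul_left _
  rw [pointSum]
  simp_rw [e]
  rw [Summable.tsum_finsetSum fun k _ => hs k]
  refine Finset.sum_congr rfl fun k _ => ?_
  rw [jumpProcess_sub h (ht (Fin.castSucc_le_succ k)), tsum_mul_left, pointSum, Complex.ofReal_tsum]

/-- For every Lévy measure with finite mean there is a process whose paths are right continuous
and nondecreasing, and whose increments have the right joint Laplace transforms. -/
theorem exists_jump_process (hν : Integrable (fun s : ℝ≥0 => (s : ℝ)) ν) :
    ∃ (Ω : Type) (_ : MeasurableSpace Ω) (P : Measure Ω) (_ : IsProbabilityMeasure P)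
      (Y : ℝ≥0 → Ω → ℝ), (∀ t, Measurable (Y t)) ∧ (∀ ω, Y 0 ω = 0) ∧
      (∀ᵐ ω ∂P, Monotone fun t => Y t ω) ∧
      (∀ᵐ ω ∂P, ∀ t, ContinuousWithinAt (fun u => Y u ω) (Ici t) t) ∧
      ∀ (n : ℕ) (t : Fin (n + 1) → ℝ≥0), Monotone t → ∀ z : Fin n → ℂ, (∀ k, (z k).re ≤ 0) →
        ∫ ω, Complex.exp (∑ k, z k * ((Y (t k.succ) ω - Y (t k.castSucc) ω : ℝ) : ℂ)) ∂P =
          ∏ k, Complex.exp (((t k.succ - t k.castSucc : ℝ) : ℂ) *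
            ∫ s : ℝ≥0, (Complex.exp (z k * s) - 1) ∂ν) := by
  -- The points live on all of `ℝ × ℝ≥0`; those at times outside `(0, t]` are ignored by `jump 0 t`.
  obtain ⟨c, p, hp, hlam⟩ := exists_eq_sum_smul_probability ((volume : Measure ℝ).prod ν)
  have hsum : ∀ᵐ ω ∂poissonClustersMeasure c p,
      ∀ n : ℕ, Summable fun m => clusterSum (jump 0 n) (ω m) := by
    refine ae_all_iff.2 fun n => ae_summable_clusterSum (measurable_jump 0 n) ?_
    rw [← hlam]
    exact integrable_jump hν 0 n
  refine ⟨_, _, poissonClustersMeasure c p, inferInstance, jumpProcess, measurable_jumpProcess,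
    fun ω => ?_, hsum.mono fun ω h => monotone_jumpProcess h,
    hsum.mono fun ω h => continuousWithinAt_jumpProcess h, fun n t ht z hz => ?_⟩
  · simp [jumpProcess, pointSum, clusterSum, jump]
  · set g : ℝ × ℝ≥0 → ℂ := fun x => ∑ k, z k * (jump (t k.castSucc) (t k.succ) x : ℂ) with hg
    have hi : ∀ k : Fin n, Integrable (fun x => z k * (jump (t k.castSucc) (t k.succ) x : ℂ))
        ((volume : Measure ℝ).prod ν) := fun k => (integrable_jump hν _ _).ofReal.const_mul _
    have hre : ∀ (k : Fin n) x, (z k * (jump (t k.castSucc) (t k.succ) x : ℂ)).re ≤ 0 := by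
      intro k x
      rw [Complex.re_mul_ofReal]
      exact mul_nonpos_of_nonpos_of_nonneg (hz k) (jump_nonneg _ _ _)
    have hgre : ∀ x, (g x).re ≤ 0 := fun x => by
      rw [hg, Complex.re_sum]
      exact Finset.sum_nonpos fun k _ => hre k x
    have hgi : Integrable g ((volume : Measure ℝ).prod ν) := integrable_finsetSum _ fun k _ => hi k
    have hgm : Measurable g := by fun_prop
    rw [integral_congr_ae (hsum.mono fun ω h => congrArg Complex.exp (sum_mul_jumpProcess_sub h ht z)),
      integral_exp_pointSum hgm (hlam ▸ hgi) hgre, ← hlam, ← Complex.exp_sum]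
    -- Disjointness of the time intervals makes the exponent additive over the increments, so the
    -- transform factorises.
    simp_rw [hg, exp_sum_mul_jump_sub_one ht]
    rw [integral_finsetSum _ fun k _ => integrable_exp_sub_one (hi k) (hre k)]
    congr 1
    refine Finset.sum_congr rfl fun k _ => ?_
    exact integral_exp_mul_jump_sub_one (ht (Fin.castSucc_le_succ k)) (z k)

/-- For every Lévy measure with finite mean there is a driftless subordinator. -/
theorem exists_isSubordinator (hν : Integrable (fun s : ℝ≥0 => (s : ℝ)) ν) :
    ∃ (Ω : Type) (_ : MeasurableSpace Ω) (P : Measure Ω) (_ : IsProbabilityMeasure P)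
      (Y : ℝ≥0 → Ω → ℝ), IsSubordinator Y P ∧ ∀ (t : ℝ≥0) (w : ℝ), 0 < w →
        ∫ ω, Real.exp (-(w * Y t ω)) ∂P =
          Real.exp (-(t * ∫ s : ℝ≥0, (1 - Real.exp (-(w * s))) ∂ν)) := by
  obtain ⟨Ω, _, P, _, Y, hm, h0, hmono, hrc, hexp⟩ := exists_jump_process hν
  have hmd : ∀ a b, Measurable fun ω => Y b ω - Y a ω := fun a b => (hm b).sub (hm a)
  have hone : ∀ a b : ℝ≥0, a ≤ b → ∀ z : ℂ, z.re ≤ 0 →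
      ∫ ω, Complex.exp (z * ((Y b ω - Y a ω : ℝ) : ℂ)) ∂P =
        Complex.exp (((b - a : ℝ) : ℂ) * ∫ s : ℝ≥0, (Complex.exp (z * s) - 1) ∂ν) := by
    intro a b hab z hz
    have := hexp 1 ![a, b] (by simpa [Fin.monotone_iff_le_succ] using hab) (fun _ => z)
      (fun _ => hz)
    simpa using this
  have hchar : ∀ a b : ℝ≥0, a ≤ b → ∀ ξ : ℝ, charFun (P.map fun ω => Y b ω - Y a ω) ξ =
      Complex.exp (((b - a : ℝ) : ℂ) * ∫ s : ℝ≥0, (Complex.exp (ξ * Complex.I * s) - 1) ∂ν) := by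
    intro a b hab ξ
    rw [charFun_apply_real, integral_map (hmd a b).aemeasurable (by fun_prop),
      ← hone a b hab _ (by simp)]
    congr 1 with ω
    ring_nf
  refine ⟨Ω, _, P, ‹_›, Y, ⟨hm, ae_of_all _ h0, hmono, hrc, fun n t ht => ?_, fun s t => ?_⟩,
    fun t w hw => ?_⟩
  -- Purely imaginary `z` turn `hexp` into the factorisation of the joint characteristic function.
  · refine (iIndepFun_iff_charFun_pi fun i => (hmd _ _).aemeasurable).2 fun ξ => ?_
    simp_rw [hchar _ _ (ht (Fin.castSucc_le_succ _))]
    have hv : Measurable fun ω => WithLp.toLp 2 fun i : Fin n =>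
        Y (t i.succ) ω - Y (t i.castSucc) ω := by
      have := fun i : Fin n => hmd (t i.castSucc) (t i.succ)
      fun_prop
    rw [← hexp n t ht _ (fun k => by simp), charFun_apply, integral_map hv.aemeasurable (by fun_prop)]
    congr 1 with ω
    rw [PiLp.inner_apply, Complex.ofReal_sum, Finset.sum_mul]
    congr 1
    refine Finset.sum_congr rfl fun k _ => ?_
    simp only [RCLike.inner_apply, conj_trivial, Complex.ofReal_mul]
    ring
  · have := Measure.isProbabilityMeasure_map (μ := P) (hmd s (s + t)).aemeasurable
    have := Measure.isProbabilityMeasure_map (μ := P) (hm t).aemeasurable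
    refine ⟨(hmd _ _).aemeasurable, (hm t).aemeasurable,
      Measure.ext_of_charFun (funext fun ξ => ?_)⟩
    have e : Y t = fun ω => Y t ω - Y 0 ω := by ext ω; rw [h0, sub_zero]
    rw [e, hchar _ _ le_self_add, hchar _ _ zero_le]
    simp
  · have h := hone 0 t zero_le (-w : ℝ) (by simpa using hw.le)
    have e1 : ∀ ω, Complex.exp ((-w : ℝ) * ((Y t ω - Y 0 ω : ℝ) : ℂ)) =
        ((Real.exp (-(w * Y t ω)) : ℝ) : ℂ) := fun ω => by
      rw [h0, sub_zero]; push_cast; ring_nf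
    have e2 : ∀ s : ℝ≥0, Complex.exp ((-w : ℝ) * ((s : ℝ) : ℂ)) - 1 =
        ((-(1 - Real.exp (-(w * s))) : ℝ) : ℂ) := fun s => by
      push_cast; ring_nf
    simp_rw [e1, e2] at h
    rw [integral_complex_ofReal, integral_complex_ofReal, integral_neg, ← Complex.ofReal_mul,
      ← Complex.ofReal_exp, Complex.ofReal_inj] at h
    rw [h]
    simp

end PoissonSubordinator

/-! ### From Lévy densities to subordinators, and the theorem. -/

/-- Existence of a driftless subordinator with a given Lévy density, if the mean is finite. -/
theorem exists_hasLevyDensity {ρ : ℝ → ℝ} (hρm : Measurable ρ) (hρ0 : ∀ s, 0 < s → 0 ≤ ρ s)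
    (hρ : IntegrableOn (fun s => s * ρ s) (Ioi 0)) :
    ∃ (Ω : Type) (_ : MeasurableSpace Ω) (P : Measure Ω) (_ : IsProbabilityMeasure P)
      (Y : ℝ≥0 → Ω → ℝ), IsSubordinator Y P ∧ HasLevyDensity Y P ρ := by
  have hd : Measurable fun s => ENNReal.ofReal (ρ s) := hρm.ennreal_ofReal
  have hT : Measurable Real.toNNReal := measurable_real_toNNReal
  set μ := (volume.restrict (Ioi (0 : ℝ))).withDensity fun s => ENNReal.ofReal (ρ s) with hμ
  -- Since `μ` lives on `(0, ∞)`, the truncation `Real.toNNReal` only changes the type of the jump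
  -- sizes.
  have hi : Integrable (fun s : ℝ≥0 => (s : ℝ)) (μ.map Real.toNNReal) := by
    rw [integrable_map_measure (by fun_prop) hT.aemeasurable, hμ,
      integrable_withDensity_iff_integrable_smul' hd (by simp)]
    refine hρ.congr ?_
    filter_upwards [ae_restrict_mem measurableSet_Ioi] with s hs
    have hs : 0 < s := hs
    rw [ENNReal.toReal_ofReal (hρ0 s hs), Function.comp_apply, Real.coe_toNNReal s hs.le,
      smul_eq_mul, mul_comm]
  obtain ⟨Ω, _, P, _, Y, hY, hL⟩ := exists_isSubordinator hi
  refine ⟨Ω, _, P, ‹_›, Y, hY, hρ0, fun w hw => ?_, fun t w hw => ?_⟩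
  · refine (hρ.const_mul w).mono' (by fun_prop : Measurable _).aestronglyMeasurable ?_
    filter_upwards [ae_restrict_mem measurableSet_Ioi] with s hs
    have hs : 0 < s := hs
    have h0 := hρ0 s hs
    rw [Real.norm_of_nonneg (mul_nonneg (one_sub_exp_neg_nonneg (mul_pos hw hs).le) h0), ← mul_assoc]
    exact mul_le_mul_of_nonneg_right (one_sub_exp_neg_le _) h0
  · rw [hL t w hw, integral_map hT.aemeasurable (by fun_prop), hμ,
      integral_withDensity_eq_integral_toReal_smul hd (by simp)]
    congr 3
    refine setIntegral_congr_fun measurableSet_Ioi fun s hs => ?_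
    have hs : 0 < s := hs
    simp only [ENNReal.toReal_ofReal (hρ0 s hs), Real.coe_toNNReal s hs.le, smul_eq_mul]
    ring

/-- The finite-mean condition holds because `q ≤ 1` bounds `s * laplaceFrom δ q s` by `exp (-(δ *
s))`, which is integrable on `(0, ∞)`. -/
theorem exists_isBSubordinator_laplaceFrom {δ : ℝ} {q : ℝ → ℝ} (hδ : 0 < δ)
    (hqm : AEMeasurable q (volume.restrict (Ici δ)))
    (hq0 : ∀ x, δ ≤ x → 0 ≤ q x) (hq1 : ∀ x, δ ≤ x → q x ≤ 1) :
    ∃ (Ω : Type) (_ : MeasurableSpace Ω) (P : Measure Ω) (_ : IsProbabilityMeasure P)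
      (Y : ℝ≥0 → Ω → ℝ), IsBSubordinator Y P (laplaceFrom δ q) := by
  have hm := measurable_laplaceFrom hqm
  have h0 := laplaceFrom_nonneg hq0
  obtain ⟨Ω, _, P, _, Y, hY, hL⟩ := exists_hasLevyDensity hm (fun s _ => h0 s) (by
    refine (integrableOn_exp_neg_mul (δ := 0) hδ).mono' (by fun_prop : Measurable _).aestronglyMeasurable ?_
    filter_upwards [ae_restrict_mem measurableSet_Ioi] with s hs
    have hs : 0 < s := hs
    rw [Real.norm_of_nonneg (mul_nonneg hs.le (h0 s))]
    calc s * laplaceFrom δ q s ≤ s * (s⁻¹ * Real.exp (-(s * δ))) :=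
          mul_le_mul_of_nonneg_left (laplaceFrom_le hqm hq0 hq1 hs) hs.le
      _ = Real.exp (-(δ * s)) := by rw [mul_comm δ s]; field_simp)
  exact ⟨Ω, _, P, ‹_›, Y, hY, hL, isLaplaceOfMeasure_laplaceFrom hδ hqm hq0 hq1⟩

theorem theorem6p1 {Ω : Type*} [MeasurableSpace Ω] (P : Measure Ω) [IsProbabilityMeasure P]
    (δ : ℝ) (hδ : 0 < δ) (q : ℝ → ℝ) (hqm : AEMeasurable q (volume.restrict (Ici δ)))
    (hq0 : ∀ x, δ ≤ x → 0 ≤ q x) (hq1 : ∀ x, δ ≤ x → q x ≤ 1)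
    (X : ℝ≥0 → Ω → ℝ) (hX : IsBSubordinator X P (laplaceFrom δ q)) :
    -- the complementary subordinator exists, and on the product space, where it is independent
    -- of the given one, the two add up to a gamma subordinator
    (∃ (Ω' : Type) (_ : MeasurableSpace Ω') (P' : Measure Ω') (_ : IsProbabilityMeasure P')
        (Y : ℝ≥0 → Ω' → ℝ),
      IsBSubordinator Y P' (laplaceFrom δ fun x => 1 - q x) ∧
      IsGammaSubordinator δ (fun t p => Y t p.2 + X t p.1) (P.prod P')) ∧
    -- the Lévy density of a gamma(1) subordinator with scale `1/δ`, and its decomposition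
    (∀ {Ω' : Type*} [MeasurableSpace Ω'] (P' : Measure Ω') [IsProbabilityMeasure P']
        (G : ℝ≥0 → Ω' → ℝ), IsGammaSubordinator δ G P' →
      HasLevyDensity G P' fun s => s⁻¹ * Real.exp (-(s * δ))) ∧
    (∀ s : ℝ, 0 < s →
      s⁻¹ * Real.exp (-(s * δ)) = laplaceFrom δ (fun x => 1 - q x) s + laplaceFrom δ q s) ∧
    -- any independent pair of subordinators with these Lévy densities adds up to a gamma
    -- subordinator, and has the stated marginals
    (∀ {Ω' : Type*} [MeasurableSpace Ω'] (P' : Measure Ω') [IsProbabilityMeasure P']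
        (X' Y' : ℝ≥0 → Ω' → ℝ),
      IsBSubordinator X' P' (laplaceFrom δ q) →
      IsBSubordinator Y' P' (laplaceFrom δ fun x => 1 - q x) →
      IndepProcesses X' Y' P' →
      IsGammaSubordinator δ (fun t ω => Y' t ω + X' t ω) P' ∧
      ∀ θ : ℝ≥0, 0 < θ →
        IdentDistrib (fun ω => Y' θ ω + X' θ ω) (fun x : ℝ => x / δ) P' (gammaMeasure θ 1)) := by
  have hqm' : AEMeasurable (fun x => 1 - q x) (volume.restrict (Ici δ)) := by fun_prop
  have hq0' : ∀ x, δ ≤ x → 0 ≤ 1 - q x := fun x hx => sub_nonneg.2 (hq1 x hx)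
  have hq1' : ∀ x, δ ≤ x → 1 - q x ≤ 1 := fun x hx => sub_le_self _ (hq0 x hx)
  refine ⟨?_, fun P' _ G hG => hG.hasLevyDensity hδ,
    fun s hs => (laplaceFrom_one_sub_add hqm hq0 hq1 hs).symm, fun P' _ X' Y' hX' hY' h => ?_⟩
  · obtain ⟨Ω', _, P', _, Y, hY⟩ := exists_isBSubordinator_laplaceFrom hδ hqm' hq0' hq1'
    refine ⟨Ω', _, P', ‹_›, Y, hY, ?_⟩
    refine isGammaSubordinator_add hδ hqm hq0 hq1
      (hX.comp_measurePreserving measurePreserving_fst)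
      (hY.comp_measurePreserving measurePreserving_snd) ?_
    exact indepFun_prod (X := fun ω t => X t ω) (Y := fun ω t => Y t ω)
      (measurable_pi_lambda _ hX.isSubordinator.measurable)
      (measurable_pi_lambda _ hY.isSubordinator.measurable)
  · have hG := isGammaSubordinator_add hδ hqm hq0 hq1 hX' hY' h
    exact ⟨hG, hG.gamma⟩
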